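/- Let $p$ be a prime with $p\equiv 1 \pmod 5$. Then $$\sum_{k=1}^{\lfloor 4p/5\rfloor}\binom{2k}{k}(-1)^k\equiv 0\pmod{p^2} \qquad\text{and}\qquad \sum_{k=1}^{\lfloor 7p/10\rfloor}\frac{\binom{2k}{k}}{(-16)^k}\equiv 0\pmod{p^2}.$$ Here a congruence $a\equiv b\pmod{p^2}$ between rational numbers means that $a-b=p^2 r$ for some rational number $r$ whose reduced denominator is not divisible by $p$. -/

import Mathlib

/-- Congruence of rational numbers modulo `m`: `a ≡ b (mod m)` means that `a - b = m * r` for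
a rational number `r` whose (reduced) denominator is coprime to `m`. -/
def RatModEq (m : ℕ) (a b : ℚ) : Prop :=
  ∃ r : ℚ, Nat.Coprime r.den m ∧ a - b = (m : ℚ) * r

/-! Write `θ` for `euler` and `D` for a square root of 5 in `ℤ_[p]`. Put `u = √P` and let `b` be the
logarithmic derivative, under `θ`, of `(u - Q) / (u + Q)`. The proof rests on two identities `P - Q²
= c v⁵`: `(1 - 4X⁵) - 5(2X² + 2X + 1)² = -4(1 + X)⁵` and `(4 + X¹⁰) - 5(X⁵ - 2X³ + 2X)² = 4(1 -
X²)⁵`. They make `b` a polynomial times a series in `X⁵` (resp. `X¹⁰`). Its coefficients at `5m + 4`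
(resp. `10m + 7`) are `-5D` times partial sums of the binomial series. With `p = 10n + 1`, the two
sums, including `k = 0`, appear at indices `4p` and `7p`, and the value 1 at indices `4` and `7`.
The theorem is thus `b_{pj} ≡ b_j` modulo `p²` for `j = 4, 7`.

For `f = F / G`, write `f^p = f(X^p)(1 + p h)`. Applying `θ` shows that `b_{pj} - b_j ≡ p j h_{pj}`
modulo `p²` (`sq_dvd_coeff_sub_of_dvd`), so `p ∣ h_{pj}` suffices. `sq_dvd_coeff_sub_of_sub_sq_eq`
obtains this from degree bounds and from the gap in `1/u` after its constant term. -/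

namespace PowerSeries

/-! ### Euler operator, substitution `X ↦ X ^ p`, and vanishing coefficients. -/

section CommRing

variable {R : Type*} [CommRing R]

/-- The Euler operator `X d/dX`. -/
noncomputable def euler : Derivation R R⟦X⟧ R⟦X⟧ := (X : R⟦X⟧) • derivative R

theorem euler_apply (f : R⟦X⟧) : euler f = X * derivative R f := rfl

theorem coeff_euler (f : R⟦X⟧) (n : ℕ) : coeff n (euler f) = n * coeff n f := by
  rw [euler_apply]
  cases n with
  | zero => simp
  | succ n => rw [coeff_succ_X_mul, coeff_derivative]; push_cast; ring

theorem euler_mul (f g : R⟦X⟧) : euler (f * g) = f * euler g + g * euler f := by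
  rw [Derivation.leibniz]; rfl

theorem mul_euler_pow (f : R⟦X⟧) (n : ℕ) :
    f * euler (f ^ n) = (n : R⟦X⟧) * f ^ n * euler f := by
  induction n with
  | zero => simp
  | succ n ih =>
    rw [pow_succ, euler_mul]
    push_cast
    linear_combination f * ih

theorem euler_expand {p : ℕ} (hp : p ≠ 0) (f : R⟦X⟧) :
    euler (expand p hp f) = (p : R⟦X⟧) * expand p hp (euler f) := by
  ext n
  have : (p : R⟦X⟧) = C (p : R) := by simp
  rw [this, coeff_C_mul, coeff_euler, coeff_expand, coeff_expand]
  split_ifs with h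
  · obtain ⟨m, rfl⟩ := h
    rw [Nat.mul_div_cancel_left _ (Nat.pos_of_ne_zero hp), coeff_euler]
    push_cast; ring
  · simp

theorem coeff_natCast_mul (m n : ℕ) (f : R⟦X⟧) :
    coeff n ((m : R⟦X⟧) * f) = m * coeff n f := by
  have : (m : R⟦X⟧) = C (m : R) := by simp
  rw [this, coeff_C_mul]

/-- A product with a series in `X ^ p` has no coefficients at multiples of `p` if the other factor
has none. -/
theorem coeff_mul_expand_eq_zero {p : ℕ} (hp : p ≠ 0) {f : R⟦X⟧}
    (hf : ∀ i, coeff (p * i) f = 0) (g : R⟦X⟧) (j : ℕ) :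
    coeff (p * j) (f * expand p hp g) = 0 := by
  rw [coeff_mul]
  refine Finset.sum_eq_zero fun x hx => ?_
  rw [coeff_expand]
  split_ifs with h
  · have h1 : p ∣ x.1 := by
      have := Finset.HasAntidiagonal.mem_antidiagonal.1 hx
      exact (Nat.dvd_add_left h).1 (this ▸ dvd_mul_right p j)
    obtain ⟨i, hi⟩ := h1
    rw [hi, hf, zero_mul]
  · simp

theorem coeff_mul_expand_of_gap {p : ℕ} (hp : p ≠ 0) (f : R⟦X⟧) {w : R⟦X⟧} {j : ℕ}
    (hw : ∀ i, 0 < i → i ≤ j → coeff i w = 0) :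
    coeff (p * j) (f * expand p hp w) = coeff (p * j) f * coeff 0 w := by
  rw [coeff_mul, Finset.sum_eq_single (p * j, 0)]
  · rw [coeff_expand]; simp
  · rintro ⟨a, b⟩ hx hne
    have hab := Finset.HasAntidiagonal.mem_antidiagonal.1 hx
    simp only at hab
    rw [coeff_expand]
    split_ifs with h
    · obtain ⟨i, rfl⟩ := h
      rw [Nat.mul_div_cancel_left _ (Nat.pos_of_ne_zero hp), hw, mul_zero]
      · rcases Nat.eq_zero_or_pos i with rfl | h
        · simp at hab; simp [hab] at hne
        · exact h
      · exact Nat.le_of_mul_le_mul_left (by lia) (Nat.pos_of_ne_zero hp)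
    · simp
  · simp

theorem coeff_natDegree_mul_of_gap (Q : Polynomial R) {w : R⟦X⟧} {j : ℕ}
    (hQ : Q.natDegree < j) (hw : ∀ i, 0 < i → i ≤ j → coeff i w = 0) :
    coeff j ((Q : R⟦X⟧) * w) = 0 := by
  have := coeff_mul_expand_of_gap one_ne_zero (Q : R⟦X⟧) hw
  simp only [expand_one_apply, one_mul] at this
  rw [this, Polynomial.coeff_coe, Polynomial.coeff_eq_zero_of_natDegree_lt hQ, zero_mul]

/-- The rational and irrational part of `(u + Q) ^ m`, where `u ^ 2 = P`. -/
theorem exists_add_pow_eq (P Q : Polynomial R) {N : ℕ} (hP : P.natDegree ≤ N)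
    (hQ : 2 * Q.natDegree ≤ N) (m : ℕ) :
    ∃ A B : Polynomial R, 2 * A.natDegree ≤ N * (m + 1) ∧ 2 * B.natDegree ≤ N * m ∧
      ∀ u : R⟦X⟧, u ^ 2 = P → ((Q : R⟦X⟧) + u) ^ (m + 1) = A + u * B := by
  induction m with
  | zero => exact ⟨Q, 1, by simpa using hQ, by simp, by simp⟩
  | succ m ih =>
    obtain ⟨A, B, hA, hB, h⟩ := ih
    refine ⟨Q * A + P * B, A + Q * B, ?_, ?_, fun u hu => ?_⟩
    · have h1 := Polynomial.natDegree_add_le (Q * A) (P * B)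
      have h2 := Polynomial.natDegree_mul_le (p := Q) (q := A)
      have h3 := Polynomial.natDegree_mul_le (p := P) (q := B)
      have h4 : N * (m + 1 + 1) = N * m + 2 * N := by ring
      have h5 : N * (m + 1) = N * m + N := by ring
      lia
    · have h1 := Polynomial.natDegree_add_le A (Q * B)
      have h2 := Polynomial.natDegree_mul_le (p := Q) (q := B)
      have h5 : N * (m + 1) = N * m + N := by ring
      lia
    · rw [pow_succ, h u hu]
      push_cast
      linear_combination (B : R⟦X⟧) * hu

/-- For odd `m` the irrational parts cancel, leaving a polynomial of degree at most `N * m / 2`. -/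
theorem coeff_add_pow_sub_sub_pow {P Q : Polynomial R} {N : ℕ} (hP : P.natDegree ≤ N)
    (hQ : 2 * Q.natDegree ≤ N) {m : ℕ} (hm : Odd m) {u : R⟦X⟧} (hu : u ^ 2 = P) {k : ℕ}
    (hk : N * m < 2 * k) :
    coeff k ((u + (Q : R⟦X⟧)) ^ m - (u - (Q : R⟦X⟧)) ^ m) = 0 := by
  obtain ⟨l, rfl⟩ := hm
  obtain ⟨A, B, hA, -, h⟩ := exists_add_pow_eq P Q hP hQ (2 * l)
  have h1 : (u + (Q : R⟦X⟧)) ^ (2 * l + 1) - (u - (Q : R⟦X⟧)) ^ (2 * l + 1) = (A : R⟦X⟧) + A := by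
    have h2 : (u - (Q : R⟦X⟧)) ^ (2 * l + 1) = - (Q + -u) ^ (2 * l + 1) := by
      rw [← Odd.neg_pow ⟨l, rfl⟩]; ring
    rw [h2, add_comm u, h u hu, h (-u) (by rw [neg_sq, hu])]
    ring
  rw [h1, map_add, Polynomial.coeff_coe, Polynomial.coeff_eq_zero_of_natDegree_lt (by lia), add_zero]

end CommRing


/-! ### The congruence for logarithmic derivatives over `ℤ_[p]`. -/

section Padic

variable {p : ℕ} [Fact p.Prime]

theorem natCast_p_ne_zero : ((p : ℕ) : ℤ_[p]⟦X⟧) ≠ 0 := by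
  have : (p : ℤ_[p]⟦X⟧) = C (p : ℤ_[p]) := by simp
  rw [this, Ne, map_eq_zero_iff _ C_injective]
  exact_mod_cast (Fact.out : p.Prime).ne_zero

theorem expand_ne_zero (hp : p ≠ 0) {f : ℤ_[p]⟦X⟧} (hf : f ≠ 0) : expand p hp f ≠ 0 := by
  contrapose! hf
  ext n
  rw [← coeff_expand_mul p hp, hf, map_zero, map_zero]

theorem isUnit_natCast_padicInt {n : ℕ} (hn : ¬ p ∣ n) : IsUnit (n : ℤ_[p]) := by
  by_contra h0
  rw [PadicInt.not_isUnit_iff, PadicInt.norm_lt_one_iff_dvd] at h0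
  have := PadicInt.pow_p_dvd_int_iff (p := p) 1 n
  simp only [pow_one, Int.cast_natCast] at this
  exact hn (by exact_mod_cast this.1 h0)

theorem isUnit_two_padicInt (hp2 : p ≠ 2) : IsUnit (2 : ℤ_[p]) := by
  refine mod_cast isUnit_natCast_padicInt (n := 2) fun h => hp2 ?_
  exact (Nat.prime_dvd_prime_iff_eq Fact.out Nat.prime_two).1 h

theorem toZMod_eq_zero_iff_dvd (x : ℤ_[p]) : PadicInt.toZMod x = 0 ↔ (p : ℤ_[p]) ∣ x := by
  rw [← RingHom.mem_ker, PadicInt.ker_toZMod, PadicInt.maximalIdeal_eq_span_p,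
    Ideal.mem_span_singleton]

theorem exists_eq_natCast_mul_of_map_toZMod_eq_zero {f : ℤ_[p]⟦X⟧}
    (hf : map PadicInt.toZMod f = 0) : ∃ g : ℤ_[p]⟦X⟧, f = (p : ℤ_[p]⟦X⟧) * g := by
  have h (n : ℕ) : ∃ a : ℤ_[p], coeff n f = p * a := by
    rw [← dvd_def, ← toZMod_eq_zero_iff_dvd, ← coeff_map, hf, map_zero]
  choose a ha using h
  refine ⟨mk a, ?_⟩
  ext n
  rw [coeff_natCast_mul, coeff_mk, ha]

theorem map_natCast_mul_toZMod (f : ℤ_[p]⟦X⟧) :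
    map PadicInt.toZMod ((p : ℤ_[p]⟦X⟧) * f) = 0 := by
  ext n
  rw [coeff_map, coeff_natCast_mul]
  simp

theorem expand_eq_pow_of_zmod (hp : p ≠ 0) (f : (ZMod p)⟦X⟧) : expand p hp f = f ^ p := by
  have h := MvPowerSeries.map_frobenius_expand (R := ZMod p) p hp (f := f)
  rw [ZMod.frobenius_zmod] at h
  rw [← h]
  exact (MvPowerSeries.map_id (R := ZMod p) ▸ rfl)

theorem exists_pow_eq_expand_add (hp : p ≠ 0) (f : ℤ_[p]⟦X⟧) :
    ∃ E : ℤ_[p]⟦X⟧, f ^ p = expand p hp f + (p : ℤ_[p]⟦X⟧) * E := by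
  obtain ⟨E, hE⟩ := exists_eq_natCast_mul_of_map_toZMod_eq_zero (f := f ^ p - expand p hp f) (by
    rw [map_sub, map_pow, map_expand, expand_eq_pow_of_zmod, sub_self])
  exact ⟨E, by rw [← hE]; ring⟩

/-- Let `b` be the logarithmic derivative of `F / G`. If the coefficient at `p * j` of
`p⁻¹ log (f ^ p / f (X ^ p))`, where `f = F / G`, vanishes modulo `p`, then
`b_{pj} ≡ b_j` modulo `p ^ 2`. -/
theorem sq_dvd_coeff_sub_of_dvd (hp : p ≠ 0) (hp2 : p ≠ 2) {F G h b : ℤ_[p]⟦X⟧}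
    (hF : F ≠ 0) (hG : G ≠ 0) (hb : F * G * b = G * euler F - F * euler G)
    (hh : F ^ p * expand p hp G = expand p hp F * G ^ p * (1 + (p : ℤ_[p]⟦X⟧) * h)) (j : ℕ)
    (hj : (p : ℤ_[p]) ∣ coeff (p * j) h) :
    (p : ℤ_[p]) ^ 2 ∣ coeff (p * j) b - coeff j b := by
  have hF' : expand p hp F ≠ 0 := expand_ne_zero hp hF
  have hG' : expand p hp G ≠ 0 := expand_ne_zero hp hG
  have hbe := congrArg (expand p hp) hb
  simp only [map_mul, map_sub] at hbe
  have hd := congrArg euler hh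
  have e1 (f : ℤ_[p]⟦X⟧) : f * euler (f ^ p) = (p : ℤ_[p]⟦X⟧) * f ^ p * euler f :=
    mul_euler_pow f p
  have e2 : euler (1 + (p : ℤ_[p]⟦X⟧) * h) = (p : ℤ_[p]⟦X⟧) * euler h := by
    rw [map_add, Derivation.map_one_eq_zero, euler_mul, Derivation.map_natCast]; ring
  simp only [euler_mul, e2, euler_expand] at hd
  set φF := expand p hp F
  set φG := expand p hp G
  set φb := expand p hp b
  set φF' := expand p hp (euler F)
  set φG' := expand p hp (euler G)
  have key : (1 + (p : ℤ_[p]⟦X⟧) * h) * (b - φb) = euler h := by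
    have hne : (p : ℤ_[p]⟦X⟧) * φF * G ^ p * (F * G * (φF * φG)) ≠ 0 :=
      mul_ne_zero (mul_ne_zero (mul_ne_zero natCast_p_ne_zero hF') (pow_ne_zero p hG))
        (mul_ne_zero (mul_ne_zero hF hG) (mul_ne_zero hF' hG'))
    apply mul_left_cancel₀ hne
    linear_combination (F * G * φF * φG) * hd - G * φF * φG * φG * e1 F
      + (1 + (p : ℤ_[p]⟦X⟧) * h) * φF * F * φF * φG * e1 G
      - ((p : ℤ_[p]⟦X⟧) * F * G * φF * φG' + (p : ℤ_[p]⟦X⟧) * G * φF * φG * euler F) * hh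
      + (p : ℤ_[p]⟦X⟧) * (φF * G ^ p * (1 + (p : ℤ_[p]⟦X⟧) * h)) * (φF * φG * hb - F * G * hbe)
  -- This is `1 / (1 + p h) = 1 - p h + p² h² / (1 + p h)` applied to `key`.
  have key2 : b - φb = euler h - (p : ℤ_[p]⟦X⟧) * (h * euler h)
      + (p : ℤ_[p]⟦X⟧) * ((p : ℤ_[p]⟦X⟧) * (h ^ 2 * (b - φb))) := by
    rw [← key]; ring
  have key3 := congrArg (coeff (p * j)) key2
  rw [map_sub, coeff_expand_mul, map_add, map_sub] at key3
  simp only [coeff_natCast_mul, coeff_euler] at key3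
  -- Since `2 h θh = θ(h²)`, the term `p h θh` gains a second factor `p` at index `p * j`.
  have h2 : 2 * coeff (p * j) (h * euler h) = (p * j : ℕ) * coeff (p * j) (h ^ 2) := by
    rw [← coeff_euler, pow_two, euler_mul, map_add, two_mul]
  obtain ⟨a, ha⟩ := hj
  obtain ⟨i, hi⟩ := (isUnit_two_padicInt hp2).exists_left_inv
  refine ⟨j * a - i * (j * coeff (p * j) (h ^ 2)) + coeff (p * j) (h ^ 2 * (b - φb)), ?_⟩
  rw [key3, ha]
  push_cast at h2 ⊢
  linear_combination (-(p : ℤ_[p]) * i) * h2 + (p : ℤ_[p]) * coeff (p * j) (h * euler h) * hi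
theorem exists_pow_eq_add_mul (c : ℤ_[p]) : ∃ d : ℤ_[p], c ^ p = c + p * d := by
  obtain ⟨d, hd⟩ := (toZMod_eq_zero_iff_dvd (c ^ p - c)).1 (by
    rw [map_sub, map_pow, ZMod.pow_card, sub_self])
  exact ⟨d, by rw [← hd]; ring⟩

/-- Let `u ^ 2 = P` with `P - Q ^ 2 = c v ^ 5`, and let `b` be the logarithmic derivative of
`(u - Q) / (u + Q)`. Then `b_{pj} ≡ b_j` modulo `p ^ 2`, provided that `j` is large compared to the
degrees of `P` and `Q` and that `u` is constant up to degree `j`. -/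
theorem sq_dvd_coeff_sub_of_sub_sq_eq (hp2 : p ≠ 2) {P Q : Polynomial ℤ_[p]} {v w b : ℤ_[p]⟦X⟧}
    {c : ℤ_[p]} {N j : ℕ} (hc : IsUnit c) (hv : IsUnit v) (hw : (P : ℤ_[p]⟦X⟧) * w ^ 2 = 1)
    (hPQ : (P : ℤ_[p]⟦X⟧) - (Q : ℤ_[p]⟦X⟧) ^ 2 = C c * v ^ 5)
    (hP : P.natDegree ≤ N) (hQ : 2 * Q.natDegree ≤ N) (hN : N < 2 * j)
    (hw0 : ∀ i, 0 < i → i ≤ j → coeff i w = 0)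
    (hvp : ∀ (hp : p ≠ 0) i, coeff (p * i) (v ^ p) = coeff (p * i) (expand p hp v))
    (hb : C c * v ^ 5 * b =
      w * ((Q : ℤ_[p]⟦X⟧) * euler (P : ℤ_[p]⟦X⟧) - 2 * P * euler (Q : ℤ_[p]⟦X⟧))) :
    (p : ℤ_[p]) ^ 2 ∣ coeff (p * j) b - coeff j b := by
  have hpp : p.Prime := Fact.out
  have hp : p ≠ 0 := hpp.ne_zero
  have hp0 := natCast_p_ne_zero (p := p)
  set P' : ℤ_[p]⟦X⟧ := (P : ℤ_[p]⟦X⟧) with hP'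
  set Q' : ℤ_[p]⟦X⟧ := (Q : ℤ_[p]⟦X⟧) with hQ'
  obtain ⟨u, hu⟩ : ∃ u, u = P' * w := ⟨_, rfl⟩
  have huw : u * w = 1 := by rw [hu]; linear_combination hw
  have hu2 : u ^ 2 = P' := by rw [hu]; linear_combination P' * hw
  obtain ⟨F, hF⟩ : ∃ F, F = u - Q' := ⟨_, rfl⟩
  obtain ⟨G, hG⟩ : ∃ G, G = u + Q' := ⟨_, rfl⟩
  have hFG : F * G = C c * v ^ 5 := by rw [hF, hG, ← hPQ]; linear_combination hu2
  have hFGu : IsUnit (F * G) := by rw [hFG]; exact (hc.map C).mul (hv.pow 5)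
  have hFu := isUnit_of_mul_isUnit_left hFGu
  have hGu := isUnit_of_mul_isUnit_right hFGu
  obtain ⟨EF, hEF⟩ := exists_pow_eq_expand_add hp F
  obtain ⟨EG, hEG⟩ := exists_pow_eq_expand_add hp G
  obtain ⟨L, hL⟩ := exists_pow_eq_expand_add hp v
  obtain ⟨d, hd⟩ := exists_pow_eq_add_mul c
  obtain ⟨ci, hci⟩ := hc.exists_right_inv
  obtain ⟨vi, hvi⟩ := hv.exists_right_inv
  obtain ⟨i2, hi2⟩ := (isUnit_two_padicInt (p := p) hp2).exists_right_inv
  obtain ⟨g, hg⟩ := ((hGu.pow p).mul (hFu.map (expand p hp))).exists_right_inv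
  obtain ⟨h, hh⟩ : ∃ h, h = (EF * expand p hp G - expand p hp F * EG) * g := ⟨_, rfl⟩
  have hh1 : h * (G ^ p * expand p hp F) = EF * expand p hp G - expand p hp F * EG := by
    rw [hh]; linear_combination (EF * expand p hp G - expand p hp F * EG) * hg
  have hL0 (i : ℕ) : coeff (p * i) L = 0 := by
    have := congrArg (coeff (p * i)) hL
    rw [map_add, hvp hp, coeff_natCast_mul, left_eq_add] at this
    exact (mul_eq_zero.1 this).resolve_left (by exact_mod_cast hp)
  have hFGe := congrArg (expand p hp) hFG
  have hCc : (C c : ℤ_[p]⟦X⟧) ^ p = C c + (p : ℤ_[p]⟦X⟧) * C d := by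
    rw [← map_pow, hd]; simp
  -- The `p`-th power of `F G = c v⁵`, expanded with `v ^ p = v(X ^ p) + p L` and divided by `p`.
  have hK : EF * expand p hp G + EG * expand p hp F + (p : ℤ_[p]⟦X⟧) * (EF * EG) =
      C d * expand p hp v ^ 5 + 5 * C c * expand p hp v ^ 4 * L + (p : ℤ_[p]⟦X⟧) *
        (C c * (10 * L ^ 2 * expand p hp v ^ 3 + 10 * p * L ^ 3 * expand p hp v ^ 2
          + 5 * p ^ 2 * L ^ 4 * expand p hp v + p ^ 3 * L ^ 5)
        + C d * (5 * L * expand p hp v ^ 4 + p * (10 * L ^ 2 * expand p hp v ^ 3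
          + 10 * p * L ^ 3 * expand p hp v ^ 2
          + 5 * p ^ 2 * L ^ 4 * expand p hp v + p ^ 3 * L ^ 5))) := by
    have h1 : F ^ p * G ^ p = C c ^ p * (v ^ p) ^ 5 := by
      rw [← mul_pow, hFG, mul_pow, ← pow_mul, ← pow_mul, mul_comm 5]
    rw [hEF, hEG, hL, hCc] at h1
    simp only [map_mul, map_pow, expand_C] at hFGe
    apply mul_left_cancel₀ hp0
    linear_combination h1 - hFGe
  have hh2 : F ^ p * expand p hp G = expand p hp F * G ^ p * (1 + (p : ℤ_[p]⟦X⟧) * h) := by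
    linear_combination (expand p hp G) * hEF - (expand p hp F) * hEG - (p : ℤ_[p]⟦X⟧) * hh1
  have huw' := congrArg (expand p hp) huw
  have hvi' := congrArg (expand p hp) hvi
  -- Modulo `p`, `h` is `EF/F(X^p) - EG/G(X^p)`, while `hK` gives the sum of these quotients as `d/c
  -- + 5L/v(X^p)`. Multiplying `h` by `F + G = 2u`, taken at `X^p`, expresses it through this sum
  -- and `EG - EF`.
  have hmod : map PadicInt.toZMod h = map PadicInt.toZMod
      (C (d * ci) * expand p hp (Q' * w) + 5 * (L * expand p hp (vi * (Q' * w)))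
        - (EG - EF) * expand p hp w) := by
    have hpz : map (PadicInt.toZMod (p := p)) (p : ℤ_[p]⟦X⟧) = 0 := by
      simpa using map_natCast_mul_toZMod (1 : ℤ_[p]⟦X⟧)
    have hGp := congrArg (map PadicInt.toZMod) hEG
    rw [map_add, map_mul, hpz, zero_mul, add_zero] at hGp
    have hi2' : map PadicInt.toZMod (2 : ℤ_[p]⟦X⟧) * map PadicInt.toZMod (C i2) = 1 := by
      rw [← map_mul, ← map_ofNat C 2, ← map_mul, hi2]; simp
    have hci' : map PadicInt.toZMod (C c) * map PadicInt.toZMod (C ci) = 1 := by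
      rw [← map_mul, ← map_mul, hci]; simp
    have hne : map PadicInt.toZMod (expand p hp F) * map PadicInt.toZMod (expand p hp G) ≠ 0 :=
      (((hFu.map (expand p hp)).map (map PadicInt.toZMod)).mul
        ((hGu.map (expand p hp)).map (map PadicInt.toZMod))).ne_zero
    have a1 := congrArg (map PadicInt.toZMod) hh1
    have a2 := congrArg (map PadicInt.toZMod) hK
    have a3 := congrArg (map PadicInt.toZMod) hFGe
    have a4 := congrArg (map PadicInt.toZMod) huw'
    have a5 := congrArg (map PadicInt.toZMod) hvi'
    have a6 := congrArg (map PadicInt.toZMod) (congrArg (expand p hp) hF)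
    have a7 := congrArg (map PadicInt.toZMod) (congrArg (expand p hp) hG)
    rw [map_add, map_mul _ (p : ℤ_[p]⟦X⟧), map_add _ (_ + _), map_mul _ (p : ℤ_[p]⟦X⟧), hpz,
      zero_mul, zero_mul, add_zero, add_zero] at a2
    rw [map_mul, map_mul, hGp] at a1
    simp only [map_mul, map_add, map_sub, map_pow, expand_C, map_one, map_ofNat]
      at a1 a2 a3 a4 a5 a6 a7 hi2' hci' ⊢
    rw [← hP', ← hQ'] at *
    generalize map PadicInt.toZMod (expand p hp F) = f at *
    generalize map PadicInt.toZMod (expand p hp G) = g' at *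
    generalize map PadicInt.toZMod (expand p hp u) = fu at *
    generalize map PadicInt.toZMod (expand p hp Q') = fQ at *
    generalize map PadicInt.toZMod (expand p hp w) = fw at *
    generalize map PadicInt.toZMod (expand p hp v) = fv at *
    generalize map PadicInt.toZMod (expand p hp vi) = fvi at *
    generalize map PadicInt.toZMod h = H at *
    generalize map PadicInt.toZMod EF = ef at *
    generalize map PadicInt.toZMod EG = eg at *
    generalize map PadicInt.toZMod L = l at *
    generalize map PadicInt.toZMod (C d) = dd at *
    generalize map PadicInt.toZMod (C c) = cc at *
    generalize map PadicInt.toZMod (C ci) = cci at *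
    generalize map PadicInt.toZMod (C i2) = t at *
    have b2 : ef * g' + eg * f = f * g' * (dd * cci + 5 * l * fvi) := by
      rw [a2, a3]
      linear_combination (-dd * fv ^ 5) * hci' - (5 * cc * fv ^ 4 * l) * a5
    have b1 : (f + g') * (H * (f * g')) =
        (f * g') * ((g' - f) * (dd * cci + 5 * l * fvi) - 2 * (eg - ef)) := by
      linear_combination (f + g') * a1 + (g' - f) * b2
    have b3 : (f + g') * H = (g' - f) * (dd * cci + 5 * l * fvi) - 2 * (eg - ef) :=
      mul_left_cancel₀ hne (by linear_combination b1)
    rw [a6, a7] at b3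
    linear_combination t * fw * b3 - 2 * t * H * a4 - H * hi2'
      + (dd * cci * (fQ * fw) + 5 * (l * (fvi * (fQ * fw))) - (eg - ef) * fw) * hi2'
  refine sq_dvd_coeff_sub_of_dvd hp hp2 hFu.ne_zero hGu.ne_zero ?_ hh2 j ?_
  · have hPe : euler P' = 2 * (u * euler u) := by
      rw [← hu2, pow_two, euler_mul]; ring
    rw [hFG, hb, hPe, hF, hG, map_sub, map_add]
    linear_combination 2 * Q' * euler u * huw + 2 * euler Q' * w * hu2 - 2 * u * euler Q' * huw
  · rw [← toZMod_eq_zero_iff_dvd, ← coeff_map, hmod, coeff_map]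
    have hQw : coeff j (Q' * w) = 0 := coeff_natDegree_mul_of_gap Q (by lia) hw0
    -- `G ^ p - F ^ p` is a polynomial of degree below `p * j`, and `2 Q(X^p)` has no term there
    -- either.
    have hB : coeff (p * j) (EG - EF) = 0 := by
      have h1 := coeff_add_pow_sub_sub_pow hP hQ (hpp.odd_of_ne_two hp2) hu2 (k := p * j)
        (by nlinarith [hpp.pos])
      have hQj : coeff j Q' = 0 := by
        rw [hQ', Polynomial.coeff_coe, Polynomial.coeff_eq_zero_of_natDegree_lt (by lia)]
      rw [← hQ', ← hG, ← hF, hEF, hEG] at h1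
      have h2 : expand p hp G + (p : ℤ_[p]⟦X⟧) * EG - (expand p hp F + (p : ℤ_[p]⟦X⟧) * EF) =
          expand p hp (Q' + Q') + (p : ℤ_[p]⟦X⟧) * (EG - EF) := by
        rw [hF, hG]; simp only [map_add, map_sub]; ring
      rw [h2, map_add, coeff_expand_mul, map_add, hQj, coeff_natCast_mul, add_zero, zero_add] at h1
      exact (mul_eq_zero.1 h1).resolve_left (by exact_mod_cast hp)
    have h5 : (5 : ℤ_[p]⟦X⟧) = ((5 : ℕ) : ℤ_[p]⟦X⟧) := by norm_cast
    rw [map_sub, map_add, coeff_C_mul, coeff_expand_mul, hQw, h5, coeff_natCast_mul,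
      coeff_mul_expand_eq_zero hp hL0, coeff_mul_expand_of_gap hp _ hw0, hB]
    simp

end Padic


/-! ### The central binomial series and the geometric series. -/

section CommRing

variable {R : Type*} [CommRing R]

theorem euler_X_pow (n : ℕ) : euler (X ^ n : R⟦X⟧) = (n : R⟦X⟧) * X ^ n := by
  ext m
  rw [coeff_euler, coeff_natCast_mul, coeff_X_pow]
  split_ifs with h <;> simp [h]

theorem euler_C (r : R) : euler (C r : R⟦X⟧) = 0 := by
  rw [euler_apply, derivative_C, mul_zero]

theorem euler_ofNat (n : ℕ) [n.AtLeastTwo] : euler (ofNat(n) : R⟦X⟧) = 0 := by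
  rw [← map_ofNat C n, euler_C]

theorem coe_polynomial_ofNat (n : ℕ) [n.AtLeastTwo] :
    ((ofNat(n) : Polynomial R) : R⟦X⟧) = ofNat(n) := by
  rw [← map_ofNat C n, ← Polynomial.coe_C, map_ofNat]

theorem coeff_ofNat_mul (k l : ℕ) [k.AtLeastTwo] (f : R⟦X⟧) :
    coeff l ((ofNat(k) : R⟦X⟧) * f) = (ofNat(k) : R) * coeff l f := by
  rw [← map_ofNat C k, coeff_C_mul]

theorem coeff_X_pow_mul_expand_self {e : ℕ} (he : e ≠ 0) (g : R⟦X⟧) (m r : ℕ) :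
    coeff (e * m + r) (X ^ r * expand e he g) = coeff m g := by
  rw [coeff_X_pow_mul, coeff_expand_mul]

theorem coeff_X_pow_mul_expand_of_ne {e : ℕ} (he : e ≠ 0) (g : R⟦X⟧) {m r i : ℕ}
    (h : i % e ≠ r % e) : coeff (e * m + r) (X ^ i * expand e he g) = 0 := by
  rw [coeff_X_pow_mul']
  split_ifs with hi
  · refine coeff_expand_of_not_dvd e he _ fun ⟨k, hk⟩ => h ?_
    have : e * m + r = e * k + i := by lia
    rw [← Nat.mul_add_mod e m r, this, Nat.mul_add_mod]
  · rfl

/-- The intermediate binomial terms have exponents `e * m` with `0 < m < p`, never multiples of `p`.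
-/
theorem coeff_one_add_pow_eq_coeff_expand {p : ℕ} (hp : p.Prime) {a : R} (ha : a ^ p = a) {e : ℕ}
    (he : ¬ p ∣ e) (i : ℕ) :
    coeff (p * i) ((1 + C a * X ^ e) ^ p) =
      coeff (p * i) (expand p hp.ne_zero (1 + C a * X ^ e)) := by
  obtain ⟨k, hk⟩ : ∃ k, p = k + 1 := ⟨p - 1, by have := hp.pos; lia⟩
  have h1 : (1 + C a * X ^ e : R⟦X⟧) ^ p = expand p hp.ne_zero (1 + C a * X ^ e) +
      ∑ m ∈ Finset.range k, C (a ^ (m + 1) * (p.choose (m + 1) : R)) * X ^ (e * (m + 1)) := by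
    rw [add_comm, add_pow]
    conv_lhs => rw [show p + 1 = k + 1 + 1 by lia]
    rw [Finset.sum_range_succ, Finset.sum_range_succ', ← hk]
    have h2 : (C a * X ^ e : R⟦X⟧) ^ p = C a * (X ^ p) ^ e := by
      rw [mul_pow, ← map_pow, ha, ← pow_mul, ← pow_mul, mul_comm e]
    simp only [map_add, map_mul, map_pow, map_one, expand_C, expand_X, one_pow, mul_one, pow_zero,
      Nat.choose_zero_right, Nat.choose_self, Nat.cast_one, h2, map_natCast, pow_mul, mul_pow]
    rw [add_comm (C a * _), add_comm (1 : R⟦X⟧), add_assoc, add_comm]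
    simp only [mul_right_comm, ← pow_mul]
    ring
  rw [h1, map_add, map_sum, Finset.sum_eq_zero, add_zero]
  intro m hm
  rw [coeff_C_mul, coeff_X_pow, if_neg, mul_zero]
  intro h
  have h3 : p ∣ e * (m + 1) := h ▸ dvd_mul_right p i
  have h4 := Nat.le_of_dvd m.succ_pos ((hp.dvd_mul.1 h3).resolve_left he)
  have := Finset.mem_range.1 hm
  lia

/-- The series `∑ binom(2k, k) (a X) ^ k`. -/
noncomputable def centralBinomSeries (a : R) : R⟦X⟧ :=
  mk fun k => (Nat.choose (2 * k) k : R) * a ^ k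

/-- The coefficient recurrence is a first-order differential equation, so `θ` kills the left side;
in characteristic zero only its constant term remains. -/
theorem one_sub_mul_centralBinomSeries_sq [IsDomain R] [CharZero R] (a : R) :
    (1 - C (4 * a) * X) * centralBinomSeries a ^ 2 = 1 := by
  have h1 : (1 - C (4 * a) * X) * euler (centralBinomSeries a) =
      C (2 * a) * X * centralBinomSeries a := by
    ext n
    rw [sub_mul, one_mul, map_sub, mul_assoc, mul_assoc, coeff_C_mul, coeff_C_mul, coeff_euler]
    cases n with
    | zero => simp
    | succ n =>
      rw [coeff_succ_X_mul, coeff_succ_X_mul, coeff_euler, centralBinomSeries, coeff_mk, coeff_mk]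
      have := Nat.succ_mul_centralBinom_succ n
      rw [Nat.centralBinom_eq_two_mul_choose, Nat.centralBinom_eq_two_mul_choose] at this
      have h := congrArg (Nat.cast (R := R)) this
      push_cast at h ⊢
      linear_combination a ^ (n + 1) * h
  have h2 : euler ((1 - C (4 * a) * X) * centralBinomSeries a ^ 2) = 0 := by
    have hX : euler (X : R⟦X⟧) = X := by simpa using euler_X_pow (R := R) 1
    rw [pow_two, euler_mul, euler_mul, map_sub, euler_mul, hX, euler_C,
      Derivation.map_one_eq_zero]
    simp only [map_mul, map_ofNat] at h1 ⊢
    linear_combination 2 * centralBinomSeries a * h1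
  ext n
  rcases Nat.eq_zero_or_pos n with rfl | hn
  · simp [centralBinomSeries, coeff_zero_eq_constantCoeff]
  · have := congrArg (coeff n) h2
    rw [coeff_euler, map_zero] at this
    rw [(mul_eq_zero.1 this).resolve_left (by exact_mod_cast hn.ne'), coeff_one, if_neg hn.ne']

theorem one_sub_mul_mk_pow (a : R) : (1 - C a * X) * mk (fun k => a ^ k) = 1 := by
  ext n
  rw [sub_mul, one_mul, map_sub, mul_assoc, coeff_C_mul]
  cases n with
  | zero => simp
  | succ n => rw [coeff_succ_X_mul]; simp [pow_succ, mul_comm, coeff_one]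

theorem coeff_expand_eq_zero_of_gap {e : ℕ} (he : e ≠ 0) (g : R⟦X⟧) {i : ℕ} (h0 : 0 < i)
    (hi : i < e) : coeff i (expand e he g) = 0 :=
  coeff_expand_of_not_dvd e he _ fun h => absurd (Nat.le_of_dvd h0 h) (by lia)

end CommRing

/-! ### The two sums in `ℤ_[p]`. -/

section Padic

variable {p : ℕ} [Fact p.Prime]

theorem isUnit_five_padicInt (hp5 : p % 5 = 1) : IsUnit (5 : ℤ_[p]) := by
  refine mod_cast isUnit_natCast_padicInt (n := 5) fun h => ?_
  have h5 := (Nat.prime_dvd_prime_iff_eq Fact.out Nat.prime_five).1 h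
  rw [h5] at hp5
  norm_num at hp5

theorem isUnit_of_sq_eq_five (hp5 : p % 5 = 1) {D : ℤ_[p]} (hD : D ^ 2 = 5) : IsUnit D :=
  (isUnit_pow_iff two_ne_zero).1 (hD ▸ isUnit_five_padicInt hp5)

/-- Quadratic reciprocity, then Hensel's lemma. -/
theorem exists_padicInt_sq_eq_five (hp2 : p ≠ 2) (hp5 : p % 5 = 1) :
    ∃ D : ℤ_[p], D ^ 2 = 5 := by
  have : Fact (Nat.Prime 5) := ⟨Nat.prime_five⟩
  have h1 : IsSquare ((5 : ℕ) : ZMod p) := by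
    rw [← ZMod.exists_sq_eq_prime_iff_of_mod_four_eq_one (p := 5) (q := p) (by norm_num) hp2]
    have : (p : ZMod 5) = 1 := by
      rw [← ZMod.natCast_mod, hp5, Nat.cast_one]
    rw [this]
    exact IsSquare.one
  obtain ⟨s, hs⟩ := h1
  obtain ⟨a, rfl⟩ := ZMod.ringHom_surjective (PadicInt.toZMod (p := p)) s
  have hdvd : (p : ℤ_[p]) ∣ a ^ 2 - 5 := by
    rw [← toZMod_eq_zero_iff_dvd, map_sub, map_pow, pow_two, ← hs, map_ofNat]
    simp
  have hu : IsUnit a := by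
    by_contra h
    rw [PadicInt.not_isUnit_iff, PadicInt.norm_lt_one_iff_dvd] at h
    have h6 : (p : ℤ_[p]) ∣ 5 := by
      simpa using dvd_sub (dvd_pow h two_ne_zero) hdvd
    exact PadicInt.prime_p.not_isUnit (isUnit_of_dvd_unit h6 (isUnit_five_padicInt hp5))
  have hd : ‖(Polynomial.aeval a) (Polynomial.derivative
      (Polynomial.X ^ 2 - 5 : Polynomial ℤ_[p]))‖ = 1 := by
    rw [← PadicInt.isUnit_iff]
    simpa [one_add_one_eq_two] using (isUnit_two_padicInt hp2).mul hu
  obtain ⟨D, hD, -⟩ := hensels_lemma (p := p) (F := (Polynomial.X ^ 2 - 5 : Polynomial ℤ_[p]))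
    (a := a) (by
      rw [hd, one_pow, PadicInt.norm_lt_one_iff_dvd]
      simpa using hdvd)
  exact ⟨D, by simpa [sub_eq_zero] using hD⟩

theorem sq_dvd_sum_choose_mul_neg_one_pow {n : ℕ} (hp : p = 10 * n + 1) :
    (p : ℤ_[p]) ^ 2 ∣
      ∑ k ∈ Finset.range (8 * n + 1), (Nat.choose (2 * k) k : ℤ_[p]) * (-1) ^ k - 1 := by
  have hp2 : p ≠ 2 := by lia
  obtain ⟨D, hD⟩ := exists_padicInt_sq_eq_five (p := p) hp2 (by lia)
  have h5 : (5 : ℕ) ≠ 0 := by norm_num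
  obtain ⟨g, hg⟩ : ∃ g : ℤ_[p]⟦X⟧, g = centralBinomSeries 1 * mk fun k => (-1) ^ k := ⟨_, rfl⟩
  have hw := congrArg (expand 5 h5) (one_sub_mul_centralBinomSeries_sq (1 : ℤ_[p]))
  have hgeo := congrArg (expand 5 h5) (one_sub_mul_mk_pow (-1 : ℤ_[p]))
  simp only [map_mul, map_sub, map_one, map_pow, map_ofNat, expand_X, map_neg, mul_one]
    at hw hgeo
  have hC : (C D : ℤ_[p]⟦X⟧) ^ 2 = 5 := by rw [← map_pow, hD, map_ofNat]
  have hX : euler (X : ℤ_[p]⟦X⟧) = X := by simpa using euler_X_pow (R := ℤ_[p]) 1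
  have h4 : IsUnit (-4 : ℤ_[p]) := by
    have := ((isUnit_two_padicInt hp2).mul (isUnit_two_padicInt hp2)).neg
    norm_num at this ⊢
    exact this
  -- This is `D X (2X² - 2X + 1) w / (1 + X)`, with `1 / (1 + X)` written as `(1 - X + X² - X³ + X⁴)
  -- / (1 + X⁵)`. Only `X ^ 4` has exponent 4 modulo 5.
  obtain ⟨b, hb⟩ : ∃ b : ℤ_[p]⟦X⟧, b = C D * (X ^ 1 * expand 5 h5 g - 3 * (X ^ 2 * expand 5 h5 g)
      + 5 * (X ^ 3 * expand 5 h5 g) - 5 * (X ^ 4 * expand 5 h5 g) + 5 * (X ^ 5 * expand 5 h5 g)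
      - 4 * (X ^ 6 * expand 5 h5 g) + 2 * (X ^ 7 * expand 5 h5 g)) := ⟨_, rfl⟩
  have hcoeff (m : ℕ) : coeff (5 * m + 4) b = -5 * D * coeff m g := by
    have hz (i : ℕ) (hi : i % 5 ≠ 4 % 5) := coeff_X_pow_mul_expand_of_ne h5 g (m := m) hi
    rw [hb, coeff_C_mul]
    simp only [map_add, map_sub, coeff_ofNat_mul]
    rw [hz 1 (by norm_num), hz 2 (by norm_num), hz 3 (by norm_num), hz 5 (by norm_num),
      hz 6 (by norm_num), hz 7 (by norm_num), coeff_X_pow_mul_expand_self]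
    ring
  have key := sq_dvd_coeff_sub_of_sub_sq_eq hp2
    (P := (1 - 4 * Polynomial.X ^ 5 : Polynomial ℤ_[p]))
    (Q := Polynomial.C D * (2 * Polynomial.X ^ 2 + 2 * Polynomial.X + 1))
    (v := 1 + C 1 * X ^ 1) (w := expand 5 h5 (centralBinomSeries 1)) (b := b) (c := -4)
    (N := 5) (j := 4) h4 (by rw [isUnit_iff_constantCoeff]; simp)
    (by simp only [Polynomial.coe_sub, Polynomial.coe_one, Polynomial.coe_mul, Polynomial.coe_pow,
          Polynomial.coe_X, coe_polynomial_ofNat]; exact hw)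
    (by
      simp only [Polynomial.coe_sub, Polynomial.coe_add, Polynomial.coe_one, Polynomial.coe_mul,
        Polynomial.coe_pow, Polynomial.coe_X, coe_polynomial_ofNat, Polynomial.coe_C, map_neg,
        map_ofNat, map_one]
      linear_combination (-(2 * X ^ 2 + 2 * X + 1) ^ 2) * hC)
    (by compute_degree) (by
      have : (Polynomial.C D * (2 * Polynomial.X ^ 2 + 2 * Polynomial.X + 1)).natDegree ≤ 2 := by
        compute_degree
      lia) (by norm_num)
    (fun i h0 hi => coeff_expand_eq_zero_of_gap h5 _ h0 (by lia))
    (fun _ i => coeff_one_add_pow_eq_coeff_expand Fact.out (one_pow p)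
      (by simpa using (Fact.out : p.Prime).ne_one) i)
    (by
      simp only [Polynomial.coe_sub, Polynomial.coe_add, Polynomial.coe_one, Polynomial.coe_mul,
        Polynomial.coe_pow, Polynomial.coe_X, coe_polynomial_ofNat, Polynomial.coe_C, map_neg,
        map_ofNat, map_one, map_sub, map_add, euler_mul, euler_X_pow, hX, euler_C,
        Derivation.map_one_eq_zero, euler_ofNat, hb, hg, map_mul]
      push_cast
      linear_combination (-4 * (1 + X) ^ 4 * C D * X * (2 * X ^ 2 - 2 * X + 1) *
        expand 5 h5 (centralBinomSeries 1)) * hgeo)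
  rw [show p * 4 = 5 * (8 * n) + 4 by lia, hcoeff, show coeff 4 b = _ from hcoeff 0, hg] at key
  have h0 : coeff 0 (centralBinomSeries (1 : ℤ_[p]) * mk fun k => (-1) ^ k) = 1 := by
    simp [centralBinomSeries, coeff_zero_eq_constantCoeff]
  have h1 : coeff (8 * n) (centralBinomSeries (1 : ℤ_[p]) * mk fun k => (-1) ^ k) =
      ∑ k ∈ Finset.range (8 * n + 1), (Nat.choose (2 * k) k : ℤ_[p]) * (-1) ^ k := by
    rw [coeff_mul, Finset.Nat.sum_antidiagonal_eq_sum_range_succ_mk]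
    refine Finset.sum_congr rfl fun k hk => ?_
    -- `8 * n` is even, so the sign `(-1) ^ (8 * n - k)` equals `(-1) ^ k`.
    have hk' : k ≤ 8 * n := by have := Finset.mem_range.1 hk; lia
    have : (-1 : ℤ_[p]) ^ (8 * n - k) * (-1) ^ k = (-1) ^ k * (-1) ^ k := by
      rw [← pow_add, ← pow_add, Nat.sub_add_cancel hk', Even.neg_one_pow ⟨4 * n, by ring⟩,
        Even.neg_one_pow ⟨k, rfl⟩]
    have := mul_right_cancel₀ (pow_ne_zero k (by norm_num : (-1 : ℤ_[p]) ≠ 0)) this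
    simp [centralBinomSeries, this]
  rw [h0, h1, ← mul_sub] at key
  refine (IsUnit.dvd_mul_left ?_).1 key
  exact (isUnit_five_padicInt (by lia)).neg.mul (isUnit_of_sq_eq_five (by lia) hD)

theorem sq_dvd_sum_choose_mul_pow {n : ℕ} (hp : p = 10 * n + 1) {a : ℤ_[p]} (ha : 16 * a = -1) :
    (p : ℤ_[p]) ^ 2 ∣
      ∑ k ∈ Finset.range (7 * n + 1), (Nat.choose (2 * k) k : ℤ_[p]) * a ^ k - 1 := by
  have hp2 : p ≠ 2 := by lia
  obtain ⟨D, hD⟩ := exists_padicInt_sq_eq_five (p := p) hp2 (by lia)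
  obtain ⟨t, ht⟩ := (isUnit_two_padicInt (p := p) hp2).exists_right_inv
  have h10 : (10 : ℕ) ≠ 0 := by norm_num
  obtain ⟨g, hg⟩ : ∃ g : ℤ_[p]⟦X⟧, g = centralBinomSeries a * mk fun k => 1 ^ k := ⟨_, rfl⟩
  have hw := congrArg (expand 10 h10) (one_sub_mul_centralBinomSeries_sq a)
  have hgeo := congrArg (expand 10 h10) (one_sub_mul_mk_pow (1 : ℤ_[p]))
  have hC : (C D : ℤ_[p]⟦X⟧) ^ 2 = 5 := by rw [← map_pow, hD, map_ofNat]
  have hCt : 2 * (C t : ℤ_[p]⟦X⟧) = 1 := by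
    rw [← map_one C, ← ht, map_mul, map_ofNat]
  have hCa : 16 * (C a : ℤ_[p]⟦X⟧) = -1 := by
    rw [← map_one C, ← map_neg, ← ha, map_mul, map_ofNat]
  simp only [map_mul, map_sub, map_one, map_pow, map_ofNat, expand_X, one_mul, expand_C]
    at hw hgeo
  have hX : euler (X : ℤ_[p]⟦X⟧) = X := by simpa using euler_X_pow (R := ℤ_[p]) 1
  have h4 : IsUnit (4 : ℤ_[p]) := by
    have := (isUnit_two_padicInt hp2).mul (isUnit_two_padicInt hp2)
    norm_num at this ⊢
    exact this
  -- This is `-D X (X⁴ + 2X² + 2) (2w) / (1 - X²)`, with denominator turned into `1 - X¹⁰`; here `w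
  -- = 1 / √(4 + X¹⁰)`, whence the factor `t = 1/2` below.
  obtain ⟨b, hb⟩ : ∃ b : ℤ_[p]⟦X⟧, b = C D * (-2 * (X ^ 1 * expand 10 h10 g)
      - 4 * (X ^ 3 * expand 10 h10 g) - 5 * (X ^ 5 * expand 10 h10 g)
      - 5 * (X ^ 7 * expand 10 h10 g) - 5 * (X ^ 9 * expand 10 h10 g)
      - 3 * (X ^ 11 * expand 10 h10 g) - X ^ 13 * expand 10 h10 g) := ⟨_, rfl⟩
  have hcoeff (m : ℕ) : coeff (10 * m + 7) b = -5 * D * coeff m g := by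
    have hz (i : ℕ) (hi : i % 10 ≠ 7 % 10) := coeff_X_pow_mul_expand_of_ne h10 g (m := m) hi
    rw [hb, coeff_C_mul]
    simp only [map_sub, neg_mul, map_neg, coeff_ofNat_mul]
    rw [hz 1 (by norm_num), hz 3 (by norm_num), hz 5 (by norm_num), hz 9 (by norm_num),
      hz 11 (by norm_num), hz 13 (by norm_num), coeff_X_pow_mul_expand_self]
    ring
  have key := sq_dvd_coeff_sub_of_sub_sq_eq hp2
    (P := (4 + Polynomial.X ^ 10 : Polynomial ℤ_[p]))
    (Q := Polynomial.C D * (Polynomial.X ^ 5 - 2 * Polynomial.X ^ 3 + 2 * Polynomial.X))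
    (v := 1 + C (-1) * X ^ 2) (w := C t * expand 10 h10 (centralBinomSeries a)) (b := b) (c := 4)
    (N := 10) (j := 7) h4 (by rw [isUnit_iff_constantCoeff]; simp)
    (by
      simp only [Polynomial.coe_add, Polynomial.coe_pow, Polynomial.coe_X, coe_polynomial_ofNat]
      linear_combination hw + (2 * C t + 1) * (1 + X ^ 10 * (- 4 * C a)) *
        expand 10 h10 (centralBinomSeries a) ^ 2 * hCt
        + C t ^ 2 * X ^ 10 * expand 10 h10 (centralBinomSeries a) ^ 2 * hCa)
    (by
      simp only [Polynomial.coe_sub, Polynomial.coe_add, Polynomial.coe_mul,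
        Polynomial.coe_pow, Polynomial.coe_X, coe_polynomial_ofNat, Polynomial.coe_C, map_neg,
        map_ofNat, map_one]
      linear_combination (-(X ^ 5 - 2 * X ^ 3 + 2 * X) ^ 2) * hC)
    (by compute_degree) (by
      have : (Polynomial.C D * (Polynomial.X ^ 5 - 2 * Polynomial.X ^ 3
          + 2 * Polynomial.X)).natDegree ≤ 5 := by
        compute_degree
      lia) (by norm_num)
    (fun i h0 hi => by
      rw [coeff_C_mul, coeff_expand_eq_zero_of_gap h10 _ h0 (by lia), mul_zero])
    (fun _ i => coeff_one_add_pow_eq_coeff_expand Fact.out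
      ((Fact.out : p.Prime).odd_of_ne_two hp2).neg_one_pow
      (fun h => hp2 ((Nat.prime_dvd_prime_iff_eq Fact.out Nat.prime_two).1 h)) i)
    (by
      simp only [Polynomial.coe_sub, Polynomial.coe_add, Polynomial.coe_mul,
        Polynomial.coe_pow, Polynomial.coe_X, coe_polynomial_ofNat, Polynomial.coe_C, map_neg,
        map_ofNat, map_one, map_sub, map_add, euler_mul, euler_X_pow, hX, euler_C,
        euler_ofNat, hb, hg, map_mul]
      push_cast
      linear_combination (-4 * (1 - X ^ 2) ^ 4 * C D * X * (X ^ 4 + 2 * X ^ 2 + 2) *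
        expand 10 h10 (centralBinomSeries a)) * hgeo + (4 * (1 - X ^ 2) ^ 4 * C D * X *
        (X ^ 4 + 2 * X ^ 2 + 2) * expand 10 h10 (centralBinomSeries a)) * hCt)
  rw [show p * 7 = 10 * (7 * n) + 7 by lia, hcoeff, show coeff 7 b = _ from hcoeff 0, hg] at key
  have h0 : coeff 0 (centralBinomSeries a * mk fun k => 1 ^ k) = 1 := by
    simp [centralBinomSeries, coeff_zero_eq_constantCoeff]
  have h1 : coeff (7 * n) (centralBinomSeries a * mk fun k => 1 ^ k) =
      ∑ k ∈ Finset.range (7 * n + 1), (Nat.choose (2 * k) k : ℤ_[p]) * a ^ k := by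
    rw [coeff_mul, Finset.Nat.sum_antidiagonal_eq_sum_range_succ_mk]
    simp [centralBinomSeries]
  rw [h0, h1, ← mul_sub] at key
  refine (IsUnit.dvd_mul_left ?_).1 key
  exact (isUnit_five_padicInt (by lia)).neg.mul (isUnit_of_sq_eq_five (by lia) hD)

end Padic

end PowerSeries

/-! ### Transfer from `ℤ_[p]` to integers and rationals. -/

theorem sum_Icc_one_eq_sum_range_sub {M : Type*} [AddCommGroup M] (f : ℕ → M) (n : ℕ) :
    ∑ k ∈ Finset.Icc 1 n, f k = ∑ k ∈ Finset.range (n + 1), f k - f 0 := by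
  rw [Finset.sum_range_succ', add_sub_cancel_right, Finset.range_eq_Ico,
    Finset.sum_Ico_add' f 0 n 1]
  rfl

theorem ratModEq_zero_of_dvd {p : ℕ} [Fact p.Prime] {n : ℕ} {x : ℚ} {y : ℤ_[p]}
    (hxy : (x : ℚ_[p]) = y) (hy : (p : ℤ_[p]) ^ n ∣ y) : RatModEq (p ^ n) x 0 := by
  have hp : p ≠ 0 := (Fact.out : p.Prime).ne_zero
  obtain ⟨z, rfl⟩ := hy
  refine ⟨x / (p : ℚ) ^ n, ?_, ?_⟩
  · have hz : ((x / (p : ℚ) ^ n : ℚ) : ℚ_[p]) = z := by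
      have : (p : ℚ_[p]) ≠ 0 := by exact_mod_cast hp
      push_cast at hxy ⊢
      rw [hxy]
      field_simp
    have h := (Padic.norm_rat_le_one_iff_padicValuation_le_one p
      (x := x / (p : ℚ) ^ n)).1 (by rw [hz]; exact z.2)
    exact Nat.Coprime.pow_right n (((Nat.Prime.coprime_iff_not_dvd Fact.out).2
      (Rat.padicValuation_le_one_iff.1 h)).symm)
  · have : (p : ℚ) ≠ 0 := by exact_mod_cast hp
    push_cast
    field_simp
    ring

theorem theorem2 (p : ℕ) (hp : p.Prime) (hp5 : p ≡ 1 [MOD 5]) :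
    (∑ k ∈ Finset.Icc 1 (4 * p / 5), (Nat.choose (2 * k) k : ℤ) * (-1) ^ k
        ≡ 0 [ZMOD (p : ℤ) ^ 2]) ∧
    RatModEq (p ^ 2)
      (∑ k ∈ Finset.Icc 1 (7 * p / 10), (Nat.choose (2 * k) k : ℚ) / (-16) ^ k) 0 := by
  have : Fact p.Prime := ⟨hp⟩
  have h5 : p % 5 = 1 := hp5
  have hp2 : p ≠ 2 := by rintro rfl; norm_num at h5
  obtain ⟨n, hn⟩ : ∃ n, p = 10 * n + 1 := by
    obtain ⟨m, hm⟩ := hp.odd_of_ne_two hp2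
    exact ⟨p / 10, by lia⟩
  rw [show 4 * p / 5 = 8 * n by lia, show 7 * p / 10 = 7 * n by lia]
  constructor
  · rw [Int.modEq_zero_iff_dvd, ← PadicInt.pow_p_dvd_int_iff, sum_Icc_one_eq_sum_range_sub]
    simpa using PowerSeries.sq_dvd_sum_choose_mul_neg_one_pow hn
  · obtain ⟨t, ht⟩ := (PowerSeries.isUnit_two_padicInt (p := p) hp2).exists_right_inv
    -- `t` is `1/2` in `ℤ_[p]`, so `-t ^ 4` represents `-1/16`.
    have ha : 16 * (-t ^ 4) = -1 := by
      linear_combination (-8 * t ^ 3 - 4 * t ^ 2 - 2 * t - 1) * ht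
    refine ratModEq_zero_of_dvd ?_ (PowerSeries.sq_dvd_sum_choose_mul_pow hn ha)
    have ha' : (16 : ℚ_[p]) * ((-t ^ 4 : ℤ_[p]) : ℚ_[p]) = -1 := by
      exact_mod_cast congrArg (fun x : ℤ_[p] => (x : ℚ_[p])) ha
    have ha2 : ((-t ^ 4 : ℤ_[p]) : ℚ_[p]) = (-16)⁻¹ := by
      refine eq_inv_of_mul_eq_one_left ?_
      linear_combination -ha'
    rw [sum_Icc_one_eq_sum_range_sub, PadicInt.coe_sub, PadicInt.coe_sum]
    simp only [PadicInt.coe_mul, PadicInt.coe_pow, ha2, inv_pow]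
    push_cast
    simp [div_eq_mul_inv]
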